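/- **Setting.** A bandit problem consists of a (possibly infinite) reservoir $\mathcal A$ of arms with a probability distribution on it, and for each arm $a\in\mathcal A$ a reward distribution $\nu_a$ supported on $[0,1]$, with mean $\mu_a$; the maximum $\mu^*=\max_{a\in\mathcal A}\mu_a$ is attained. In each of the rounds $t=1,\dots,T$ the learner either picks a new arm, drawn independently from the reservoir distribution, or plays again an arm that was played in an earlier round; writing $a_t$ for the arm played, she receives a reward drawn from $\nu_{a_t}$, independently of the past given $a_t$. A bandit algorithm is a rule for these choices, possibly randomised, that uses only the past choices and rewards. Its regret at horizon $T$ is $R(T)=\sum_{t=1}^T(\mu^*-\mu_{a_t})$. For $\Delta>0$ and $p^*\in[0,1)$ let $\mathfrak B_{\Delta,p^*}$ be the set of bandit problems in which an arm drawn from the reservoir is optimal (has mean $\mu^*$) with probability at least $p^*$, there are sub-optimal arms, and $\mu^*-\mu_{sub}\ge\Delta$, where $\mu_{sub}=\sup\{\mu_a:\mu_a\neq\mu^*\}$. **Theorem 2.** Let $\Delta\in(0,1/4)$ and $p^*\in(0,1/4]$. For every horizon $T$ and every bandit algorithm there is a bandit problem in $\mathfrak B_{\Delta,p^*}$ on which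 $$\mathbb E\,R(T)\;\ge\;\min\left(\frac1{33}\,\frac{\max\{\log(\Delta^2T/16),0\}}{p^*\Delta},\ \sqrt T\right).$$ For fixed $\Delta$ and $p^*$ the right-hand side is asymptotically equivalent to $\frac{1}{33}\,\frac{\log T}{p^*\Delta}$ as $T\to\infty$. -/

import Mathlib

open MeasureTheory ProbabilityTheory

noncomputable section

/-- A stochastic bandit problem over a (possibly infinite) reservoir of arms: a measurable space of
arms, a probability measure on it (the law of an arm picked at random from the reservoir), and for
each arm a reward distribution supported in `[0, 1]`; the largest mean reward is attained. -/
structure BanditProblem where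
  Arm : Type
  [measurableSpaceArm : MeasurableSpace Arm]
  reservoir : Measure Arm
  [isProbabilityMeasure_reservoir : IsProbabilityMeasure reservoir]
  reward : Kernel Arm ℝ
  [isMarkovKernel_reward : IsMarkovKernel reward]
  reward_support : ∀ a, ∀ᵐ y ∂(reward a), y ∈ Set.Icc (0 : ℝ) 1
  exists_best : ∃ a, ∀ b, ∫ y, y ∂(reward b) ≤ ∫ y, y ∂(reward a)

namespace BanditProblem

attribute [instance] measurableSpaceArm isProbabilityMeasure_reservoir isMarkovKernel_reward

variable (P : BanditProblem)

/-- The mean reward of an arm. -/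
def mean (a : P.Arm) : ℝ := ∫ y, y ∂(P.reward a)

/-- The highest mean, a maximum by `exists_best`. -/
def bestMean : ℝ := ⨆ a, P.mean a

/-- The set of optimal arms. -/
def optimalArms : Set P.Arm := {a | P.mean a = P.bestMean}

/-- The second highest mean: the supremum of the means of the sub-optimal arms. -/
def subMean : ℝ := sSup (P.mean '' {a | P.mean a ≠ P.bestMean})

/-- The proportion of optimal arms in the reservoir. -/
def optimalProportion : ℝ := P.reservoir.real P.optimalArms

/-- The class of bandit problems in which the proportion of optimal arms is at least `p` and the gap
between the highest and the second highest mean is at least `Δ`. There has to be some sub-optimal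
arm, so that the second highest mean is a genuine supremum. -/
def InClass (Δ p : ℝ) : Prop :=
  p ≤ P.optimalProportion ∧ (∃ a, P.mean a ≠ P.bestMean) ∧ Δ ≤ |P.bestMean - P.subMean|

end BanditProblem

/-- What the learner decides and observes in round `t` (rounds are numbered `0, 1, 2, …`): a choice
in `{0, …, t}` and a reward. The choice `s < t` means that the arm played in the past round `s` is
played again; the choice `t` means that a new arm is picked from the reservoir. -/
abbrev ObservedRound (t : ℕ) : Type := Fin (t + 1) × ℝ

/-- What is known to the learner before round `t`: her choices and the rewards so far. -/
abbrev ObservedHistory (t : ℕ) : Type := (i : Fin t) → ObservedRound i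

/-- A (randomised) bandit algorithm: in each round a choice drawn from a probability distribution
that depends measurably on the past choices and rewards. -/
structure BanditAlgorithm where
  choice : (t : ℕ) → Kernel (ObservedHistory t) (Fin (t + 1))
  [isMarkovKernel_choice : ∀ t, IsMarkovKernel (choice t)]

attribute [instance] BanditAlgorithm.isMarkovKernel_choice

namespace BanditProblem

variable (P : BanditProblem)

/-- A full round: the learner's choice, the arm that is actually played, and the reward. -/
abbrev Round (t : ℕ) : Type := (Fin (t + 1) × P.Arm) × ℝ

/-- The full history of the rounds before round `t`. -/
abbrev History (t : ℕ) : Type := (i : Fin t) → P.Round i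

/-- The part of the history that the learner sees: choices and rewards, not the identity of the
arms in the reservoir. -/
def observed {t : ℕ} (h : P.History t) : ObservedHistory t := fun i => ((h i).1.1, (h i).2)

lemma measurable_observed {t : ℕ} : Measurable (P.observed (t := t)) := by
  unfold observed
  fun_prop

/-- The law of the arm played in round `t`, given the history and the choice: the arm of a past
round, or a new arm drawn from the reservoir independently of the past. -/
def armKernel (t : ℕ) : Kernel (P.History t × Fin (t + 1)) P.Arm where
  toFun x := if hs : x.2.val < t then Measure.dirac (x.1 ⟨x.2.val, hs⟩).1.2 else P.reservoir
  measurable' := by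
    refine measurable_from_prod_countable_left fun c => ?_
    by_cases hs : c.val < t
    · simp only [hs, dif_pos]
      exact Measure.measurable_dirac.comp
        (measurable_snd.comp (measurable_fst.comp (measurable_pi_apply (⟨c.val, hs⟩ : Fin t))))
    · simp only [hs, dif_neg, not_false_eq_true]
      exact measurable_const

instance (t : ℕ) : IsMarkovKernel (P.armKernel t) := by
  refine ⟨fun x => ?_⟩
  simp only [armKernel, Kernel.coe_mk]
  split_ifs <;> infer_instance

/-- The law of round `t` given the history: the algorithm draws its choice from what it has
observed, the arm is determined by `armKernel`, and the reward is drawn from that arm. -/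
def roundKernel (alg : BanditAlgorithm) (t : ℕ) : Kernel (P.History t) (P.Round t) :=
  ((alg.choice t).comap P.observed P.measurable_observed ⊗ₖ P.armKernel t) ⊗ₖ
    P.reward.comap (fun x : P.History t × (Fin (t + 1) × P.Arm) => x.2.2)
      (measurable_snd.comp measurable_snd)

instance (alg : BanditAlgorithm) (t : ℕ) : IsMarkovKernel (P.roundKernel alg t) := by
  unfold roundKernel
  infer_instance

/-- Append round `t` to a history. -/
def extend {t : ℕ} (x : P.History t × P.Round t) : P.History (t + 1) :=
  Fin.snoc (α := fun i : Fin (t + 1) => P.Round i) x.1 x.2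

lemma measurable_extend {t : ℕ} : Measurable (P.extend (t := t)) := by
  refine measurable_pi_iff.mpr fun i => ?_
  refine Fin.lastCases ?_ (fun j => ?_) i
  · simp only [extend, Fin.snoc_last]
    exact measurable_snd
  · simp only [extend, Fin.snoc_castSucc]
    exact (measurable_pi_apply j).comp measurable_fst

/-- The law of the history of the first `t` rounds when the algorithm runs on the problem. -/
def historyLaw (alg : BanditAlgorithm) : (t : ℕ) → Measure (P.History t)
  | 0 => Measure.dirac fun i => i.elim0
  | t + 1 => ((historyLaw alg t) ⊗ₘ (P.roundKernel alg t)).map P.extend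

instance (alg : BanditAlgorithm) (t : ℕ) : IsProbabilityMeasure (P.historyLaw alg t) := by
  induction t with
  | zero => unfold historyLaw; infer_instance
  | succ t ih =>
    unfold historyLaw
    exact Measure.isProbabilityMeasure_map P.measurable_extend.aemeasurable

/-- The cumulative regret over the `T` rounds of a history. -/
def regret {T : ℕ} (h : P.History T) : ℝ := ∑ i : Fin T, (P.bestMean - P.mean (h i).1.2)

/-- The expected cumulative regret of an algorithm at horizon `T`. -/
def expectedRegret (alg : BanditAlgorithm) (T : ℕ) : ℝ :=
  ∫ h, P.regret h ∂(P.historyLaw alg T)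

end BanditProblem

end

/-!
A bandit problem with three kinds of arms is perturbed by improving one kind that the learner cannot
single out. Arms `1` and `2` have proportion `p` each in the reservoir and arm `0` the rest. In the
base problem the means are `1/2 - Δ, 1/2, 1/2 - Δ`, so that arm `1` is the best one; in the raised
problem arm `2` has mean `1/2 + Δ` and is the best one. Both problems are in the class.

The laws of the full history under the two problems differ only by the rewards of arm `2`
(`BanditProblem.lintegral_historyLaw_withReward`), so their Kullback-Leibler divergence is that of
one reward, `2 * Δ * log ((1/2 + Δ) / (1/2 - Δ)) ≤ 12 * Δ ^ 2`, times the mean number of plays of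
arm `2` in the base problem (`integral_logLikelihood`). In the base problem arms `0` and `2` have
the same rewards, so the learner cannot tell them apart, and arm `2` has only its share
`p / (1 - p) ≤ 4 / 3 * p` of the plays of sub-optimal arms (`BanditProblem.lintegral_mul_weight_eq`,
`one_sub_mul_integral_playCount`). As these plays cost `Δ` each, the divergence is at most
`16 * p * Δ` times the regret `A` on the base problem.

On the other hand every play of an arm other than `1` costs `Δ` on the base problem, and every play
of arm `1` costs `Δ` on the raised one. By an inequality of Bretagnolle-Huber type
(`BanditProblem.mul_exp_neg_le_integral_add`) the two regrets sum to at least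
`Δ * T / 2 * exp (-16 * p * Δ * A)` (`le_expectedRegret_add`). If both were below the claimed bound,
then the exponential would be at least `4 / (Δ * √T)` and the sum at least `2 * √T`, a contradiction
(`exists_min_le`).
-/

noncomputable section

/-! ### One round of the interaction -/

namespace BanditProblem

open scoped ENNReal

variable (P : BanditProblem) (alg : BanditAlgorithm)

/-- The mean of `f` of the history extended by one round, given the history `h` and the choice `c`
of the learner in that round. -/
def nextMean {t : ℕ} (f : P.History (t + 1) → ℝ≥0∞) (h : P.History t) (c : Fin (t + 1)) : ℝ≥0∞ :=
  ∫⁻ a, ∫⁻ y, f (P.extend (h, ((c, a), y))) ∂P.reward a ∂P.armKernel t (h, c)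

variable {P}

@[simp] lemma extend_last {t : ℕ} (h : P.History t) (r : P.Round t) :
    P.extend (h, r) (Fin.last t) = r := by
  simp [BanditProblem.extend]

@[simp] lemma extend_castSucc {t : ℕ} (h : P.History t) (r : P.Round t) (i : Fin t) :
    P.extend (h, r) i.castSucc = h i := by
  simp [BanditProblem.extend]

lemma measurable_lintegral_reward {t : ℕ} {f : P.History (t + 1) → ℝ≥0∞} (hf : Measurable f)
    (c : Fin (t + 1)) :
    Measurable fun x : P.History t × P.Arm =>
      ∫⁻ y, f (P.extend (x.1, ((c, x.2), y))) ∂P.reward x.2 := by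
  have h := Measurable.lintegral_kernel_prod_right'
    (κ := P.reward.comap (Prod.snd : P.History t × P.Arm → P.Arm) measurable_snd)
    (f := fun z : (P.History t × P.Arm) × ℝ => f (P.extend (z.1.1, ((c, z.1.2), z.2))))
    (hf.comp (P.measurable_extend.comp (by fun_prop)))
  simpa using h

lemma nextMean_of_lt {t : ℕ} {f : P.History (t + 1) → ℝ≥0∞} (hf : Measurable f)
    (h : P.History t) (c : Fin (t + 1)) (hc : c.val < t) :
    P.nextMean f h c = ∫⁻ y, f (P.extend (h, ((c, (h ⟨c, hc⟩).1.2), y)))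
      ∂P.reward (h ⟨c, hc⟩).1.2 := by
  have : P.armKernel t (h, c) = Measure.dirac (h ⟨c, hc⟩).1.2 := by
    simp [armKernel, hc]
  rw [nextMean, this, lintegral_dirac']
  exact (measurable_lintegral_reward hf c).comp measurable_prodMk_left

lemma nextMean_of_not_lt {t : ℕ} (f : P.History (t + 1) → ℝ≥0∞)
    (h : P.History t) (c : Fin (t + 1)) (hc : ¬ c.val < t) :
    P.nextMean f h c = ∫⁻ a, ∫⁻ y, f (P.extend (h, ((c, a), y))) ∂P.reward a ∂P.reservoir := by
  have : P.armKernel t (h, c) = P.reservoir := by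
    simp [armKernel, hc]
  rw [nextMean, this]

lemma measurable_nextMean {t : ℕ} {f : P.History (t + 1) → ℝ≥0∞} (hf : Measurable f)
    (c : Fin (t + 1)) : Measurable fun h => P.nextMean f h c := by
  by_cases hc : c.val < t
  · simp_rw [nextMean_of_lt hf _ c hc]
    exact (measurable_lintegral_reward hf c).comp
      (measurable_id.prodMk (by fun_prop : Measurable fun h : P.History t => (h ⟨c, hc⟩).1.2))
  · simp_rw [nextMean_of_not_lt f _ c hc]
    exact (measurable_lintegral_reward hf c).lintegral_prod_right'

lemma measurable_choice (t : ℕ) (c : Fin (t + 1)) :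
    Measurable fun h : P.History t => alg.choice t (P.observed h) {c} :=
  (Kernel.measurable_coe _ (measurableSet_singleton c)).comp P.measurable_observed

/-- One step of the interaction, as a formula for the expectation of a function of the history. -/
lemma lintegral_historyLaw_succ {t : ℕ} {f : P.History (t + 1) → ℝ≥0∞} (hf : Measurable f) :
    ∫⁻ h, f h ∂P.historyLaw alg (t + 1) =
      ∫⁻ h, ∑ c, P.nextMean f h c * alg.choice t (P.observed h) {c} ∂P.historyLaw alg t := by
  have hfe : Measurable fun x : P.History t × P.Round t => f (P.extend x) :=
    hf.comp P.measurable_extend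
  rw [historyLaw, lintegral_map hf P.measurable_extend, Measure.lintegral_compProd hfe]
  refine lintegral_congr fun h => ?_
  have hfh : Measurable fun r : P.Round t => f (P.extend (h, r)) :=
    hfe.comp measurable_prodMk_left
  rw [roundKernel, Kernel.lintegral_compProd _ _ _ hfh, Kernel.lintegral_compProd,
    lintegral_fintype]
  · rfl
  · exact Measurable.lintegral_kernel_prod_right'
      (κ := P.reward.comap (Prod.snd : Fin (t + 1) × P.Arm → P.Arm) measurable_snd) hfh

/-! ### Arms that the learner cannot tell apart -/

/-- Two histories are indistinguishable if they have the same choices and rewards and the arms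
played in each round have the same reward distribution. -/
def Indistinguishable {t : ℕ} (h h' : P.History t) : Prop :=
  ∀ i, (h i).1.1 = (h' i).1.1 ∧ P.reward (h i).1.2 = P.reward (h' i).1.2 ∧ (h i).2 = (h' i).2

lemma Indistinguishable.extend {t : ℕ} {h h' : P.History t} (hh : Indistinguishable h h')
    {a a' : P.Arm} (ha : P.reward a = P.reward a') (c : Fin (t + 1)) (y : ℝ) :
    Indistinguishable (P.extend (h, ((c, a), y))) (P.extend (h', ((c, a'), y))) := by
  intro i
  refine Fin.lastCases ?_ (fun j => ?_) i
  · simp [ha]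
  · simpa using hh j

lemma Indistinguishable.refl {t : ℕ} (h : P.History t) : Indistinguishable h h :=
  fun _ => ⟨rfl, rfl, rfl⟩

lemma Indistinguishable.observed_eq {t : ℕ} {h h' : P.History t} (hh : Indistinguishable h h') :
    P.observed h = P.observed h' :=
  funext fun i => Prod.ext (hh i).1 (hh i).2.2

lemma nextMean_congr {t : ℕ} {f : P.History (t + 1) → ℝ≥0∞} (hf : Measurable f)
    (hinv : ∀ h h', Indistinguishable h h' → f h = f h') {h h' : P.History t}
    (hh : Indistinguishable h h') (c : Fin (t + 1)) :
    P.nextMean f h c = P.nextMean f h' c := by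
  by_cases hc : c.val < t
  · rw [nextMean_of_lt hf _ _ hc, nextMean_of_lt hf _ _ hc, (hh ⟨c, hc⟩).2.1]
    exact lintegral_congr fun y => hinv _ _ (hh.extend (hh ⟨c, hc⟩).2.1 c y)
  · rw [nextMean_of_not_lt _ _ _ hc, nextMean_of_not_lt _ _ _ hc]
    exact lintegral_congr fun a => lintegral_congr fun y => hinv _ _ (hh.extend rfl c y)

/-- Weights on arms that agree on average over each class of arms with a common reward
distribution cannot be told apart by the learner: this passes from a draw from the reservoir to the
arm played in any round. -/
theorem lintegral_mul_weight_eq {u v : P.Arm → ℝ≥0∞} (hu : Measurable u) (hv : Measurable v)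
    (huv : ∀ g : P.Arm → ℝ≥0∞, Measurable g → (∀ a b, P.reward a = P.reward b → g a = g b) →
      ∫⁻ a, g a * u a ∂P.reservoir = ∫⁻ a, g a * v a ∂P.reservoir) :
    ∀ {t : ℕ} (f : P.History t → ℝ≥0∞), Measurable f →
      (∀ h h', Indistinguishable h h' → f h = f h') → ∀ s : Fin t,
      ∫⁻ h, f h * u (h s).1.2 ∂P.historyLaw alg t =
        ∫⁻ h, f h * v (h s).1.2 ∂P.historyLaw alg t := by
  intro t
  induction t with
  | zero => exact fun _ _ _ s => s.elim0
  | succ t ih =>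
    intro f hf hinv s
    have hmc := fun c => (measurable_nextMean hf c).mul (measurable_choice (P := P) alg t c)
    have hinvc : ∀ c h h', Indistinguishable h h' →
        P.nextMean f h c * alg.choice t (P.observed h) {c} =
          P.nextMean f h' c * alg.choice t (P.observed h') {c} := fun c h h' hh => by
      rw [nextMean_congr hf hinv hh c, hh.observed_eq]
    have hmw : ∀ {w : P.Arm → ℝ≥0∞}, Measurable w → ∀ j : Fin (t + 1),
        Measurable fun h : P.History (t + 1) => f h * w (h j).1.2 :=
      fun hw j => hf.mul (hw.comp (by fun_prop))
    rw [lintegral_historyLaw_succ alg (hmw hu s), lintegral_historyLaw_succ alg (hmw hv s)]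
    have hrow : ∀ h c a, Measurable fun y => f (P.extend (h, ((c, a), y))) := fun h c a =>
      hf.comp (P.measurable_extend.comp (by fun_prop))
    refine Fin.lastCases ?_ (fun j => ?_) s
    -- The weight bears on the new round: an arm played again is reduced to the round in which the
    -- choice points, with the rest of the integrand absorbed in the test function; a new arm is
    -- the hypothesis on the reservoir.
    · have hsplit : ∀ {w : P.Arm → ℝ≥0∞}, Measurable w →
          ∫⁻ h, ∑ c, P.nextMean (fun h => f h * w (h (Fin.last t)).1.2) h c *
              alg.choice t (P.observed h) {c} ∂P.historyLaw alg t =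
            ∑ c, ∫⁻ h, P.nextMean (fun h => f h * w (h (Fin.last t)).1.2) h c *
              alg.choice t (P.observed h) {c} ∂P.historyLaw alg t := fun hw =>
        lintegral_finsetSum _ fun c _ =>
          (measurable_nextMean (hmw hw _) c).mul (measurable_choice alg t c)
      rw [hsplit hu, hsplit hv]
      refine Finset.sum_congr rfl fun c _ => ?_
      by_cases hc : c.val < t
      · have hold : ∀ {w : P.Arm → ℝ≥0∞}, Measurable w → ∀ h,
            P.nextMean (fun h => f h * w (h (Fin.last t)).1.2) h c *
              alg.choice t (P.observed h) {c} =
            P.nextMean f h c * alg.choice t (P.observed h) {c} * w (h ⟨c, hc⟩).1.2 := by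
          intro w hw h
          rw [nextMean_of_lt (hmw hw _) _ _ hc, nextMean_of_lt hf _ _ hc]
          simp only [extend_last]
          rw [lintegral_mul_const _ (hrow h c _)]
          ring
        simp_rw [hold hu, hold hv]
        exact ih _ (hmc c) (hinvc c) ⟨c, hc⟩
      · refine lintegral_congr fun h => ?_
        have hnew : ∀ {w : P.Arm → ℝ≥0∞},
            P.nextMean (fun h => f h * w (h (Fin.last t)).1.2) h c =
            ∫⁻ a, (∫⁻ y, f (P.extend (h, ((c, a), y))) ∂P.reward a) * w a ∂P.reservoir := by
          intro w
          rw [nextMean_of_not_lt _ _ _ hc]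
          simp only [extend_last]
          refine lintegral_congr fun a => ?_
          exact lintegral_mul_const _ (hrow h c _)
        rw [hnew, hnew, huv]
        · exact (measurable_lintegral_reward hf c).comp measurable_prodMk_left
        · intro a b hab
          rw [hab]
          exact lintegral_congr fun y => hinv _ _ ((Indistinguishable.refl h).extend hab c y)
    -- The weight bears on a past round: the new round is integrated out.
    · have hpast : ∀ {w : P.Arm → ℝ≥0∞}, Measurable w → ∀ h,
          ∑ c, P.nextMean (fun h => f h * w (h j.castSucc).1.2) h c *
              alg.choice t (P.observed h) {c} =
            (∑ c, P.nextMean f h c * alg.choice t (P.observed h) {c}) * w (h j).1.2 := by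
        intro w hw h
        rw [Finset.sum_mul]
        refine Finset.sum_congr rfl fun c _ => ?_
        simp only [nextMean, extend_castSucc]
        have : ∀ a, ∫⁻ y, f (P.extend (h, ((c, a), y))) * w (h j).1.2 ∂P.reward a =
            (∫⁻ y, f (P.extend (h, ((c, a), y))) ∂P.reward a) * w (h j).1.2 :=
          fun a => lintegral_mul_const _ (hrow h c a)
        have hm : Measurable fun a => ∫⁻ y, f (P.extend (h, ((c, a), y))) ∂P.reward a :=
          (measurable_lintegral_reward hf c).comp measurable_prodMk_left
        simp_rw [this]
        rw [lintegral_mul_const _ hm]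
        ring
      simp_rw [hpast hu, hpast hv]
      exact ih _ (Finset.measurable_sum _ fun c _ => hmc c)
        (fun h h' hh => Finset.sum_congr rfl fun c _ => hinvc c h h' hh) j

/-! ### Change of reward distributions -/

/-- The bandit problem with the same reservoir and other reward distributions. -/
@[reducible] def withReward (P : BanditProblem) (κ : Kernel P.Arm ℝ) [IsMarkovKernel κ]
    (hκ : ∀ a, ∀ᵐ y ∂(κ a), y ∈ Set.Icc (0 : ℝ) 1)
    (hbest : ∃ a, ∀ b, ∫ y, y ∂(κ b) ≤ ∫ y, y ∂(κ a)) : BanditProblem where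
  Arm := P.Arm
  reservoir := P.reservoir
  reward := κ
  reward_support := hκ
  exists_best := hbest

/-- The likelihood ratio of a history, when `d a` is the density of one reward of arm `a`. -/
def likelihood (d : P.Arm → ℝ → ℝ≥0∞) {t : ℕ} (h : P.History t) : ℝ≥0∞ :=
  ∏ i, d (h i).1.2 (h i).2

lemma measurable_likelihood {d : P.Arm → ℝ → ℝ≥0∞} (hd : Measurable (Function.uncurry d))
    {t : ℕ} : Measurable (likelihood d (P := P) (t := t)) := by
  refine Finset.measurable_prod _ fun i _ => ?_
  exact hd.comp (g := Function.uncurry d)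
    (f := fun h : P.History t => ((h i).1.2, (h i).2)) (by fun_prop)

lemma likelihood_extend (d : P.Arm → ℝ → ℝ≥0∞) {t : ℕ} (h : P.History t) (r : P.Round t) :
    likelihood d (P.extend (h, r)) = likelihood d h * d r.1.2 r.2 := by
  simp [likelihood, Fin.prod_univ_castSucc]

/-- If only the reward distributions of two problems differ, then the law of the history under one
has a density with respect to the law under the other: the choices of the algorithm and the draws
from the reservoir cancel in the likelihood ratio. -/
theorem lintegral_historyLaw_withReward (κ : Kernel P.Arm ℝ) [IsMarkovKernel κ]
    (hκ : ∀ a, ∀ᵐ y ∂(κ a), y ∈ Set.Icc (0 : ℝ) 1)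
    (hbest : ∃ a, ∀ b, ∫ y, y ∂(κ b) ≤ ∫ y, y ∂(κ a))
    {d : P.Arm → ℝ → ℝ≥0∞} (hd : Measurable (Function.uncurry d))
    (hκd : ∀ a, κ a = (P.reward a).withDensity (d a)) :
    ∀ {t : ℕ} (f : P.History t → ℝ≥0∞), Measurable f →
      ∫⁻ h, f h ∂(P.withReward κ hκ hbest).historyLaw alg t =
        ∫⁻ h, f h * likelihood d h ∂P.historyLaw alg t := by
  intro t
  induction t with
  | zero =>
    intro f hf
    simp only [likelihood, Finset.univ_eq_empty, Finset.prod_empty, mul_one]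
    rfl
  | succ t ih =>
    intro f hf
    have hrow : ∀ h c a, Measurable fun y => f (P.extend (h, ((c, a), y))) := fun h c a =>
      hf.comp (P.measurable_extend.comp (by fun_prop))
    have hda : ∀ a, Measurable (d a) := fun a => hd.comp measurable_prodMk_left
    have hfd : Measurable fun h : P.History (t + 1) => f h * likelihood d h :=
      hf.mul (measurable_likelihood hd)
    have hnext : ∀ h c, P.nextMean (fun h => f h * likelihood d h) h c =
        (P.withReward κ hκ hbest).nextMean f h c * likelihood d h := by
      intro h c
      have hin : ∀ a, ∫⁻ y, f (P.extend (h, ((c, a), y))) *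
            likelihood d (P.extend (h, ((c, a), y))) ∂P.reward a =
          (∫⁻ y, f (P.extend (h, ((c, a), y))) ∂κ a) * likelihood d h := by
        intro a
        rw [hκd, lintegral_withDensity_eq_lintegral_mul _ (hda a) (hrow h c a),
          ← lintegral_mul_const _ ((hda a).mul (hrow h c a))]
        refine lintegral_congr fun y => ?_
        rw [likelihood_extend]
        simp only [Pi.mul_apply]
        ring
      simp only [nextMean, hin]
      exact lintegral_mul_const _ ((measurable_lintegral_reward
        (P := P.withReward κ hκ hbest) hf c).comp measurable_prodMk_left)
    rw [lintegral_historyLaw_succ alg hfd]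
    simp_rw [hnext]
    refine (lintegral_historyLaw_succ (P := P.withReward κ hκ hbest) alg hf).trans ?_
    refine (ih _ (Finset.measurable_sum _ fun c _ =>
      (measurable_nextMean (P := P.withReward κ hκ hbest) hf c).mul
        (measurable_choice (P := P.withReward κ hκ hbest) alg t c))).trans ?_
    refine lintegral_congr fun h => ?_
    rw [Finset.sum_mul]
    refine Finset.sum_congr rfl fun c _ => ?_
    rw [mul_right_comm]
    rfl

/-- A sum over the rounds of bounded functions of the arm and the reward that are centred for every
arm is centred. -/
theorem integral_sum_eq_zero {g : P.Arm × ℝ → ℝ} (hg : Measurable g) {C : ℝ}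
    (hC : ∀ x, |g x| ≤ C) (hg0 : ∀ a, ∫ y, g (a, y) ∂P.reward a = 0) (t : ℕ) :
    ∫ h, ∑ i, g ((h i).1.2, (h i).2) ∂P.historyLaw alg t = 0 := by
  induction t with
  | zero => simp
  | succ t ih =>
    have hgi : ∀ {s : ℕ} (i : Fin s),
        Measurable fun h : P.History s => g ((h i).1.2, (h i).2) :=
      fun i => hg.comp (by fun_prop)
    have hgr : Measurable fun r : P.Round t => g (r.1.2, r.2) := hg.comp (by fun_prop)
    have hS : ∀ s : ℕ, Measurable fun h : P.History s => ∑ i, g ((h i).1.2, (h i).2) :=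
      fun s => Finset.measurable_sum _ fun i _ => hgi i
    have hext : ∀ x : P.History t × P.Round t,
        ∑ i, g ((P.extend x i).1.2, (P.extend x i).2) =
          ∑ i, g ((x.1 i).1.2, (x.1 i).2) + g (x.2.1.2, x.2.2) := fun x => by
      obtain ⟨h, r⟩ := x
      simp [Fin.sum_univ_castSucc]
    have hSb : ∀ (s : ℕ) (h : P.History s), ‖∑ i, g ((h i).1.2, (h i).2)‖ ≤ s * C := fun s h =>
      (norm_sum_le _ _).trans ((Finset.sum_le_sum fun i _ => hC _).trans (by simp))
    rw [historyLaw, integral_map P.measurable_extend.aemeasurable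
      (hS (t + 1)).aestronglyMeasurable, Measure.integral_compProd]
    · rw [← ih]
      refine integral_congr_ae (Filter.Eventually.of_forall fun h => ?_)
      simp only [hext]
      rw [integral_add (integrable_const _)]
      · suffices hz : ∫ r, g (r.1.2, r.2) ∂P.roundKernel alg t h = 0 by rw [hz]; simp
        rw [roundKernel, integral_compProd]
        · simp [hg0]
        · exact Integrable.of_bound hgr.aestronglyMeasurable C
            (Filter.Eventually.of_forall fun r => hC _)
      · exact Integrable.of_bound hgr.aestronglyMeasurable C
          (Filter.Eventually.of_forall fun r => hC _)
    · exact Integrable.of_bound ((hS (t + 1)).comp P.measurable_extend).aestronglyMeasurable _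
        (Filter.Eventually.of_forall fun x => hSb (t + 1) _)

/-- The log-likelihood ratio of a history, when `ζ (a, y)` is the one of the reward `y` of arm
`a`. -/
def logLikelihood (ζ : P.Arm × ℝ → ℝ) {t : ℕ} (h : P.History t) : ℝ :=
  ∑ i, ζ ((h i).1.2, (h i).2)

lemma measurable_logLikelihood {ζ : P.Arm × ℝ → ℝ} (hζ : Measurable ζ) {t : ℕ} :
    Measurable (logLikelihood ζ (P := P) (t := t)) :=
  Finset.measurable_sum _ fun i _ => hζ.comp (by fun_prop)

lemma abs_logLikelihood_le {ζ : P.Arm × ℝ → ℝ} {C : ℝ} (hC : ∀ x, |ζ x| ≤ C) {t : ℕ}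
    (h : P.History t) : |logLikelihood ζ h| ≤ t * C :=
  (Finset.abs_sum_le_sum_abs _ _).trans ((Finset.sum_le_sum fun i _ => hC _).trans (by simp))

/-- Change of measure for the expectation of a nonnegative function of the history. -/
theorem integral_historyLaw_withReward (κ : Kernel P.Arm ℝ) [IsMarkovKernel κ]
    (hκ : ∀ a, ∀ᵐ y ∂(κ a), y ∈ Set.Icc (0 : ℝ) 1)
    (hbest : ∃ a, ∀ b, ∫ y, y ∂(κ b) ≤ ∫ y, y ∂(κ a))
    {ζ : P.Arm × ℝ → ℝ} (hζ : Measurable ζ)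
    (hκζ : ∀ a, κ a = (P.reward a).withDensity fun y => ENNReal.ofReal (Real.exp (-ζ (a, y))))
    {t : ℕ} {f : P.History t → ℝ} (hf : Measurable f) (hf0 : ∀ h, 0 ≤ f h) :
    ∫ h, f h ∂(P.withReward κ hκ hbest).historyLaw alg t =
      ∫ h, f h * Real.exp (-logLikelihood ζ h) ∂P.historyLaw alg t := by
  have hd : Measurable (Function.uncurry fun (a : P.Arm) (y : ℝ) =>
      ENNReal.ofReal (Real.exp (-ζ (a, y)))) := by
    unfold Function.uncurry
    fun_prop
  have hm := measurable_logLikelihood hζ (P := P) (t := t)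
  rw [integral_eq_lintegral_of_nonneg_ae (Filter.Eventually.of_forall hf0)
      (Measurable.aestronglyMeasurable hf),
    integral_eq_lintegral_of_nonneg_ae
      (Filter.Eventually.of_forall fun h => mul_nonneg (hf0 h) (Real.exp_pos _).le)
      (by fun_prop : Measurable fun h => f h * Real.exp (-logLikelihood ζ h)).aestronglyMeasurable]
  congr 1
  refine (lintegral_historyLaw_withReward alg κ hκ hbest hd hκζ _ hf.ennreal_ofReal).trans ?_
  refine lintegral_congr fun h => ?_
  rw [ENNReal.ofReal_mul (hf0 h), likelihood, logLikelihood, ← Finset.sum_neg_distrib,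
    Real.exp_sum, ENNReal.ofReal_prod_of_nonneg fun i _ => (Real.exp_pos _).le]

/-- The pointwise inequality behind `mul_exp_neg_le_integral_add`. With `s = exp (-K / 2)` and
`r = exp (-z / 2)` it is `min 1 (r ^ 2) ≥ s * r - s ^ 2 / 4 * (1 + r ^ 2)`, weakened by bounding
`r / s` below by a tangent line. The result is affine in `z` and `exp (-z)`, whose means are
known when `z` is a log-likelihood ratio. -/
lemma sq_mul_sub_le_min (K z : ℝ) :
    Real.exp (-K) * (1 - (z - K) / 2) - Real.exp (-K) / 4 * (1 + Real.exp (-z)) ≤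
      min 1 (Real.exp (-z)) := by
  set s := Real.exp (-K / 2)
  set r := Real.exp (-z / 2)
  have hs : Real.exp (-K) = s ^ 2 := by rw [← Real.exp_nat_mul]; congr 1; push_cast; ring
  have hr : Real.exp (-z) = r ^ 2 := by rw [← Real.exp_nat_mul]; congr 1; push_cast; ring
  have hsr : s ^ 2 * (1 - (z - K) / 2) ≤ s * r := by
    have h1 : 1 - (z - K) / 2 ≤ Real.exp (-(z - K) / 2) := by
      have := Real.add_one_le_exp (-(z - K) / 2)
      linarith
    calc s ^ 2 * (1 - (z - K) / 2) ≤ s ^ 2 * Real.exp (-(z - K) / 2) := by gcongr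
      _ = s * r := by
        rw [← hs, ← Real.exp_add, ← Real.exp_add]
        congr 1
        ring
  rw [hs, hr, le_min_iff]
  constructor <;> nlinarith [sq_nonneg (r - s / 2), sq_nonneg (1 - s * r / 2), sq_nonneg (s * r),
    sq_nonneg s]

/-- A form of the Bretagnolle-Huber inequality: a quantity `N` with values in `[0, C]` cannot be
close to `C` in mean under the first problem and close to `0` in mean under the second when the
Kullback-Leibler divergence of the laws of the history, the mean of the log-likelihood ratio under
the first, is small. -/
theorem mul_exp_neg_le_integral_add (κ : Kernel P.Arm ℝ) [IsMarkovKernel κ]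
    (hκ : ∀ a, ∀ᵐ y ∂(κ a), y ∈ Set.Icc (0 : ℝ) 1)
    (hbest : ∃ a, ∀ b, ∫ y, y ∂(κ b) ≤ ∫ y, y ∂(κ a))
    {ζ : P.Arm × ℝ → ℝ} (hζ : Measurable ζ) {M : ℝ} (hM : ∀ x, |ζ x| ≤ M)
    (hκζ : ∀ a, κ a = (P.reward a).withDensity fun y => ENNReal.ofReal (Real.exp (-ζ (a, y))))
    {t : ℕ} {C : ℝ} {N : P.History t → ℝ} (hN : Measurable N) (hN0 : ∀ h, 0 ≤ N h)
    (hNC : ∀ h, N h ≤ C) :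
    C / 2 * Real.exp (-∫ h, logLikelihood ζ h ∂P.historyLaw alg t) ≤
      ∫ h, (C - N h) ∂P.historyLaw alg t +
        ∫ h, N h ∂(P.withReward κ hκ hbest).historyLaw alg t := by
  set μ := P.historyLaw alg t
  set K := ∫ h, logLikelihood ζ h ∂μ
  have hm := measurable_logLikelihood hζ (P := P) (t := t)
  have hZ : Integrable (fun h => logLikelihood ζ h) μ :=
    Integrable.of_bound hm.aestronglyMeasurable (t * M)
      (Filter.Eventually.of_forall fun h => abs_logLikelihood_le hM h)
  have hexp : ∀ h : P.History t, Real.exp (-logLikelihood ζ h) ≤ Real.exp (t * M) := fun h =>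
    Real.exp_le_exp.mpr ((neg_le_abs _).trans (abs_logLikelihood_le hM h))
  have hD : Integrable (fun h => Real.exp (-logLikelihood ζ h)) μ := by
    refine Integrable.of_bound (by fun_prop) (Real.exp (t * M))
      (Filter.Eventually.of_forall fun h => ?_)
    rw [Real.norm_eq_abs, abs_of_pos (Real.exp_pos _)]
    exact hexp h
  have hND : Integrable (fun h => N h * Real.exp (-logLikelihood ζ h)) μ := by
    refine Integrable.of_bound (by fun_prop) (C * Real.exp (t * M))
      (Filter.Eventually.of_forall fun h => ?_)
    rw [Real.norm_eq_abs, abs_of_nonneg (mul_nonneg (hN0 h) (Real.exp_pos _).le)]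
    exact mul_le_mul (hNC h) (hexp h) (Real.exp_pos _).le ((hN0 h).trans (hNC h))
  have hCN : Integrable (fun h => C - N h) μ := by
    refine Integrable.of_bound (by fun_prop) C (Filter.Eventually.of_forall fun h => ?_)
    rw [Real.norm_eq_abs, abs_of_nonneg (sub_nonneg.mpr (hNC h))]
    linarith [hN0 h]
  have hD1 : ∫ h, Real.exp (-logLikelihood ζ h) ∂μ = 1 := by
    have := integral_historyLaw_withReward alg κ hκ hbest hζ hκζ (t := t)
      (f := fun _ => 1) measurable_const (fun _ => zero_le_one)
    simpa using this.symm
  rw [integral_historyLaw_withReward alg κ hκ hbest hζ hκζ hN hN0, ← integral_add hCN hND]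
  set e := Real.exp (-K)
  -- The mean of the lower bound of `sq_mul_sub_le_min` is `e - e / 4 * 2`.
  have hlow : ∫ h, C * (e * (1 - (logLikelihood ζ h - K) / 2) -
      e / 4 * (1 + Real.exp (-logLikelihood ζ h))) ∂μ = C / 2 * e := by
    have h1 : Integrable (fun h => (logLikelihood ζ h - K) / 2) μ :=
      (hZ.sub (integrable_const _)).div_const _
    have h2 : Integrable (fun h => e * (1 - (logLikelihood ζ h - K) / 2)) μ :=
      ((integrable_const _).sub h1).const_mul _
    have h3 : Integrable (fun h => e / 4 * (1 + Real.exp (-logLikelihood ζ h))) μ :=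
      ((integrable_const _).add hD).const_mul _
    rw [integral_const_mul, integral_sub h2 h3, integral_const_mul, integral_const_mul,
      integral_sub (integrable_const _) h1, integral_add (integrable_const _) hD,
      integral_div, integral_sub hZ (integrable_const _), hD1]
    simp only [integral_const, probReal_univ, smul_eq_mul, one_mul]
    change C * (e * (1 - (K - K) / 2) - e / 4 * (1 + 1)) = C / 2 * e
    ring
  rw [← hlow]
  refine integral_mono ?_ (hCN.add hND) fun h => ?_
  · exact (((integrable_const _).sub ((hZ.sub (integrable_const _)).div_const _)).const_mul _
      |>.sub (((integrable_const _).add hD).const_mul _)).const_mul _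
  · obtain ⟨h1, h2⟩ := le_min_iff.mp (sq_mul_sub_le_min K (logLikelihood ζ h))
    have hA := mul_le_mul_of_nonneg_left h1 (sub_nonneg.mpr (hNC h))
    have hB := mul_le_mul_of_nonneg_left h2 (hN0 h)
    linarith

/-! ### Best arm, class and sign of the regret -/

lemma bestMean_eq {P : BanditProblem} {a : P.Arm} (h : ∀ b, P.mean b ≤ P.mean a) :
    P.bestMean = P.mean a := by
  have : Nonempty P.Arm := ⟨a⟩
  exact le_antisymm (ciSup_le h)
    (le_ciSup (f := P.mean) ⟨P.mean a, by rintro _ ⟨b, rfl⟩; exact h b⟩ a)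

/-- A criterion for membership in the class, by a best arm and a gap below it. -/
lemma inClass_of_gap {P : BanditProblem} {Δ p : ℝ} (a b : P.Arm)
    (hp : p ≤ P.reservoir.real {a}) (hab : P.mean b ≠ P.mean a) (hbest : ∀ c, P.mean c ≤ P.mean a)
    (hgap : ∀ c, P.mean c ≠ P.mean a → P.mean c ≤ P.mean a - Δ) : P.InClass Δ p := by
  have hb := bestMean_eq hbest
  refine ⟨hp.trans (measureReal_mono ?_), ⟨b, hb ▸ hab⟩, ?_⟩
  · rintro _ rfl
    exact hb.symm
  · refine le_trans ?_ (le_abs_self _)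
    have : P.subMean ≤ P.mean a - Δ := by
      refine csSup_le ⟨_, b, hb ▸ hab, rfl⟩ ?_
      rintro _ ⟨c, hc, rfl⟩
      exact hgap c (hb ▸ hc)
    rw [hb]
    linarith

lemma expectedRegret_nonneg (P : BanditProblem) (alg : BanditAlgorithm) (T : ℕ) :
    0 ≤ P.expectedRegret alg T := by
  obtain ⟨a, ha⟩ := P.exists_best
  refine integral_nonneg fun h => Finset.sum_nonneg fun i _ => sub_nonneg.mpr ?_
  rw [bestMean_eq (a := a) ha]
  exact ha _

end BanditProblem

/-! ### Problems with three kinds of arms -/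

/-- The kernel that gives arm `a` the rewards `1` and `0` with probabilities `m a` and `1 - m a`. -/
def bernoulliKernel (m : Fin 3 → unitInterval) : Kernel (Fin 3) ℝ :=
  Kernel.ofFunOfCountable fun a => bernoulliMeasure 1 0 (m a)

lemma bernoulliKernel_apply (m : Fin 3 → unitInterval) (a : Fin 3) :
    bernoulliKernel m a = bernoulliMeasure 1 0 (m a) := rfl

instance (m : Fin 3 → unitInterval) : IsMarkovKernel (bernoulliKernel m) :=
  ⟨fun a => by rw [bernoulliKernel_apply]; infer_instance⟩

lemma integral_bernoulliKernel (m : Fin 3 → unitInterval) (a : Fin 3) (f : ℝ → ℝ) :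
    ∫ y, f y ∂bernoulliKernel m a = m a * f 1 + (1 - m a) * f 0 := by
  rw [bernoulliKernel_apply, integral_bernoulliMeasure]
  rfl

lemma bernoulliKernel_support (m : Fin 3 → unitInterval) (a : Fin 3) :
    ∀ᵐ y ∂bernoulliKernel m a, y ∈ Set.Icc (0 : ℝ) 1 := by
  rw [bernoulliKernel_apply, ae_iff]
  exact bernoulliMeasure_apply_of_notMem_of_notMem _ measurableSet_Icc.compl (by simp) (by simp)

lemma exists_best_bernoulliKernel (m : Fin 3 → unitInterval) :
    ∃ a, ∀ b, ∫ y, y ∂bernoulliKernel m b ≤ ∫ y, y ∂bernoulliKernel m a :=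
  Finite.exists_max _

/-- Bernoulli laws with success probabilities `q` and `q'` have the density given by the ratios of
the probabilities of the two outcomes. -/
lemma bernoulliMeasure_eq_withDensity {q q' : unitInterval} {d : ℝ → ℝ}
    (h1 : (q' : ℝ) = q * d 1) (h0 : 1 - (q' : ℝ) = (1 - q) * d 0) :
    bernoulliMeasure (1 : ℝ) 0 q' =
      (bernoulliMeasure 1 0 q).withDensity fun y => ENNReal.ofReal (d y) := by
  have e : ∀ r : unitInterval, (unitInterval.toNNReal r : ENNReal) = ENNReal.ofReal r := fun r => by
    rw [ENNReal.ofReal, Real.toNNReal_of_nonneg r.2.1]; rfl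
  ext s hs
  rw [withDensity_apply _ hs, ← lintegral_indicator hs, bernoulliMeasure_def, bernoulliMeasure_def,
    lintegral_add_measure]
  simp only [Measure.smul_apply, Measure.add_apply, lintegral_smul_measure,
    lintegral_dirac, Measure.dirac_apply' _ hs, ENNReal.smul_def, smul_eq_mul, e,
    unitInterval.coe_symm_eq]
  rw [h0, h1, ENNReal.ofReal_mul q.2.1, ENNReal.ofReal_mul (sub_nonneg.mpr q.2.2)]
  by_cases hs1 : (1 : ℝ) ∈ s <;> by_cases hs0 : (0 : ℝ) ∈ s <;> simp [hs1, hs0]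

/-- The law of an arm that is `1` or `2` with probability `p` each, and `0` otherwise. -/
def threeArmReservoir (p : ℝ) : Measure (Fin 3) :=
  ENNReal.ofReal (1 - 2 * p) • Measure.dirac 0 + ENNReal.ofReal p • Measure.dirac 1 +
    ENNReal.ofReal p • Measure.dirac 2

lemma isProbabilityMeasure_threeArmReservoir {p : ℝ} (hp : 0 ≤ p) (hp' : 2 * p ≤ 1) :
    IsProbabilityMeasure (threeArmReservoir p) := by
  refine ⟨?_⟩
  simp only [threeArmReservoir, Measure.add_apply, Measure.smul_apply, measure_univ, smul_eq_mul,
    mul_one]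
  rw [← ENNReal.ofReal_add (by linarith) hp, ← ENNReal.ofReal_add (by linarith) hp]
  ring_nf
  simp

lemma lintegral_threeArmReservoir (p : ℝ) (f : Fin 3 → ENNReal) :
    ∫⁻ a, f a ∂threeArmReservoir p =
      ENNReal.ofReal (1 - 2 * p) * f 0 + ENNReal.ofReal p * f 1 + ENNReal.ofReal p * f 2 := by
  simp only [threeArmReservoir, lintegral_add_measure, lintegral_smul_measure, lintegral_dirac,
    smul_eq_mul]

lemma threeArmReservoir_real_singleton {p : ℝ} (hp : 0 ≤ p) {a : Fin 3} (ha : a ≠ 0) :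
    (threeArmReservoir p).real {a} = p := by
  rw [measureReal_def, threeArmReservoir]
  fin_cases a <;> simp_all

/-- The bandit problem with three kinds of arms, the last two of which have proportion `p` each in
the reservoir, and with Bernoulli rewards of mean `m`. -/
@[reducible] def threeArmProblem {p : ℝ} (hp : 0 ≤ p) (hp' : 2 * p ≤ 1)
    (m : Fin 3 → unitInterval) : BanditProblem where
  Arm := Fin 3
  reservoir := threeArmReservoir p
  isProbabilityMeasure_reservoir := isProbabilityMeasure_threeArmReservoir hp hp'
  reward := bernoulliKernel m
  reward_support := bernoulliKernel_support m
  exists_best := exists_best_bernoulliKernel m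

section

variable {p : ℝ} (hp : 0 ≤ p) (hp' : 2 * p ≤ 1) (alg : BanditAlgorithm)

lemma mean_threeArmProblem (m : Fin 3 → unitInterval) (a : Fin 3) :
    (threeArmProblem hp hp' m).mean a = m a := by
  simp [BanditProblem.mean, integral_bernoulliKernel]

/-- If arms `0` and `2` have the same rewards, then in each round arm `2` has its share
`p / (1 - p)` of the plays of these two. -/
lemma one_sub_mul_integral_eq {m : Fin 3 → unitInterval} (hm : m 0 = m 2) {t : ℕ} (s : Fin t) :
    (1 - p) * ∫ h, (if (h s).1.2 = 2 then 1 else 0 : ℝ)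
        ∂(threeArmProblem hp hp' m).historyLaw alg t =
      p * ∫ h, (if (h s).1.2 = 1 then 0 else 1 : ℝ)
        ∂(threeArmProblem hp hp' m).historyLaw alg t := by
  set P := threeArmProblem hp hp' m
  have key := BanditProblem.lintegral_mul_weight_eq (P := P) alg
    (u := fun a : Fin 3 => ENNReal.ofReal ((1 - p) * if a = 2 then 1 else 0))
    (v := fun a : Fin 3 => ENNReal.ofReal (p * if a = 1 then 0 else 1))
    (measurable_of_countable _) (measurable_of_countable _) (by
      intro (g : Fin 3 → ENNReal) _ hg
      have h02 : g 0 = g 2 := hg (0 : Fin 3) (2 : Fin 3) (by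
        change bernoulliKernel m 0 = bernoulliKernel m 2
        rw [bernoulliKernel_apply, bernoulliKernel_apply, hm])
      refine (lintegral_threeArmReservoir p _).trans
        (Eq.trans ?_ (lintegral_threeArmReservoir p _).symm)
      simp only [h02, Fin.reduceEq, if_true, if_false, mul_zero, mul_one, ENNReal.ofReal_zero]
      rw [show (1 - p) = (1 - 2 * p) + p by ring, ENNReal.ofReal_add (by linarith) hp]
      ring) (t := t) (fun _ => 1) measurable_const (fun _ _ _ => rfl) s
  simp only [one_mul] at key
  have hmeas : ∀ w : Fin 3 → ℝ, Measurable fun h : P.History t => w (h s).1.2 := fun w =>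
    (measurable_of_countable w).comp (by fun_prop : Measurable fun h : P.History t => (h s).1.2)
  rw [← integral_const_mul, ← integral_const_mul,
    integral_eq_lintegral_of_nonneg_ae, integral_eq_lintegral_of_nonneg_ae, key]
  · refine Filter.Eventually.of_forall fun h => mul_nonneg hp ?_
    split_ifs <;> norm_num
  · exact (hmeas fun a => p * if a = 1 then 0 else 1).aestronglyMeasurable
  · refine Filter.Eventually.of_forall fun h => mul_nonneg (by linarith) ?_
    split_ifs <;> norm_num
  · exact (hmeas fun a => (1 - p) * if a = 2 then 1 else 0).aestronglyMeasurable

/-- The number of plays of arm `a`, as a real number. -/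
def playCount {P : BanditProblem} [DecidableEq P.Arm] (a : P.Arm) {t : ℕ} (h : P.History t) : ℝ :=
  ∑ i, if (h i).1.2 = a then 1 else 0

lemma playCount_nonneg {P : BanditProblem} [DecidableEq P.Arm] (a : P.Arm) {t : ℕ}
    (h : P.History t) : 0 ≤ playCount a h :=
  Finset.sum_nonneg fun i _ => by split_ifs <;> norm_num

lemma playCount_le {P : BanditProblem} [DecidableEq P.Arm] (a : P.Arm) {t : ℕ}
    (h : P.History t) : playCount a h ≤ t := by
  refine (Finset.sum_le_sum (g := fun _ => (1 : ℝ)) fun i _ => ?_).trans (by simp)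
  split_ifs <;> norm_num

lemma measurable_playCount {P : BanditProblem} [DecidableEq P.Arm] [MeasurableSingletonClass P.Arm]
    (a : P.Arm) {t : ℕ} : Measurable (playCount a (P := P) (t := t)) :=
  Finset.measurable_sum _ fun i _ => Measurable.ite
    ((measurableSet_singleton a).preimage
      (by fun_prop : Measurable fun h : P.History t => (h i).1.2)) measurable_const measurable_const

lemma integrable_playCount {P : BanditProblem} [DecidableEq P.Arm]
    [MeasurableSingletonClass P.Arm] (a : P.Arm) {t : ℕ} (μ : Measure (P.History t))
    [IsFiniteMeasure μ] : Integrable (fun h => playCount a h) μ :=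
  Integrable.of_bound (measurable_playCount a).aestronglyMeasurable t
    (Filter.Eventually.of_forall fun h => by
      rw [Real.norm_eq_abs, abs_of_nonneg (playCount_nonneg a h)]
      exact playCount_le a h)

lemma one_sub_mul_integral_playCount {m : Fin 3 → unitInterval} (hm : m 0 = m 2) (t : ℕ) :
    (1 - p) * ∫ h, playCount (P := threeArmProblem hp hp' m) (2 : Fin 3) h
        ∂(threeArmProblem hp hp' m).historyLaw alg t =
      p * ∫ h, (t - playCount (P := threeArmProblem hp hp' m) (1 : Fin 3) h)
        ∂(threeArmProblem hp hp' m).historyLaw alg t := by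
  set P := threeArmProblem hp hp' m
  have hint : ∀ (w : Fin 3 → ℝ) (i : Fin t),
      Integrable (fun h : P.History t => w (h i).1.2) (P.historyLaw alg t) := fun w i =>
    Integrable.of_bound ((measurable_of_countable w).comp
        (by fun_prop : Measurable fun h : P.History t => (h i).1.2)).aestronglyMeasurable
      (∑ a, |w a|) (Filter.Eventually.of_forall fun h =>
        Finset.single_le_sum (f := fun a => |w a|) (fun a _ => abs_nonneg _) (Finset.mem_univ _))
  have hcount : ∀ h : P.History t, t - playCount (P := P) (1 : Fin 3) h =
      ∑ i, (if (h i).1.2 = 1 then 0 else 1 : ℝ) := fun h => by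
    rw [sub_eq_iff_eq_add, playCount, ← Finset.sum_add_distrib]
    rw [Finset.sum_congr rfl (g := fun _ => (1 : ℝ)) fun i _ => by split_ifs <;> norm_num]
    simp
  simp_rw [hcount]
  simp only [playCount]
  rw [integral_finsetSum _ fun i _ => hint (fun a => if a = 2 then 1 else 0) i,
    integral_finsetSum _ fun i _ => hint (fun a => if a = 1 then 0 else 1) i,
    Finset.mul_sum, Finset.mul_sum]
  exact Finset.sum_congr rfl fun i _ => one_sub_mul_integral_eq hp hp' alg hm i

end

section

variable {p Δ : ℝ} (hp : 0 ≤ p) (hp' : 2 * p ≤ 1) (hΔ : 0 ≤ Δ) (hΔ' : Δ < 1 / 2)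
  (alg : BanditAlgorithm)

/-! ### The two problems of the lower bound -/

/-- Means for which arm `1` is the best one and arm `2` is a copy of arm `0`. -/
def baseMeans : Fin 3 → unitInterval :=
  ![⟨1 / 2 - Δ, by constructor <;> linarith⟩, ⟨1 / 2, by norm_num⟩,
    ⟨1 / 2 - Δ, by constructor <;> linarith⟩]

/-- The means obtained from `baseMeans` by making arm `2` the best one. -/
def raisedMeans : Fin 3 → unitInterval :=
  ![⟨1 / 2 - Δ, by constructor <;> linarith⟩, ⟨1 / 2, by norm_num⟩,
    ⟨1 / 2 + Δ, by constructor <;> linarith⟩]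

/-- The bandit problem with means `baseMeans`. -/
abbrev baseProblem : BanditProblem := threeArmProblem hp hp' (baseMeans hΔ hΔ')

/-- The bandit problem with means `raisedMeans`. -/
abbrev raisedProblem : BanditProblem := threeArmProblem hp hp' (raisedMeans hΔ hΔ')

lemma baseProblem_mean (a : Fin 3) :
    (baseProblem hp hp' hΔ hΔ').mean a = if a = 1 then 1 / 2 else 1 / 2 - Δ := by
  rw [mean_threeArmProblem]
  fin_cases a <;> simp [baseMeans]

lemma raisedProblem_mean (a : Fin 3) :
    (raisedProblem hp hp' hΔ hΔ').mean a =
      if a = 2 then 1 / 2 + Δ else if a = 1 then 1 / 2 else 1 / 2 - Δ := by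
  rw [mean_threeArmProblem]
  fin_cases a <;> simp [raisedMeans]

lemma baseProblem_mean_le (a : Fin 3) :
    (baseProblem hp hp' hΔ hΔ').mean a ≤ (baseProblem hp hp' hΔ hΔ').mean (1 : Fin 3) := by
  simp only [baseProblem_mean]
  fin_cases a <;> simp [hΔ]

lemma raisedProblem_mean_le (a : Fin 3) :
    (raisedProblem hp hp' hΔ hΔ').mean a ≤ (raisedProblem hp hp' hΔ hΔ').mean (2 : Fin 3) := by
  simp only [raisedProblem_mean]
  fin_cases a <;> simp <;> linarith

lemma baseProblem_inClass (hΔ0 : 0 < Δ) : (baseProblem hp hp' hΔ hΔ').InClass Δ p := by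
  refine BanditProblem.inClass_of_gap (1 : Fin 3) (0 : Fin 3) ?_ ?_
    (baseProblem_mean_le hp hp' hΔ hΔ') fun (c : Fin 3) => ?_
  · exact (threeArmReservoir_real_singleton hp (by decide)).ge
  · simp only [baseProblem_mean]
    simp [hΔ0.ne']
  · simp only [baseProblem_mean]
    fin_cases c <;> simp

lemma raisedProblem_inClass (hΔ0 : 0 < Δ) : (raisedProblem hp hp' hΔ hΔ').InClass Δ p := by
  refine BanditProblem.inClass_of_gap (2 : Fin 3) (1 : Fin 3) ?_ ?_
    (raisedProblem_mean_le hp hp' hΔ hΔ') fun (c : Fin 3) => ?_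
  · exact (threeArmReservoir_real_singleton hp (by decide)).ge
  · simp only [raisedProblem_mean]
    simp [hΔ0.ne']
  · simp only [raisedProblem_mean]
    fin_cases c <;> simp
    intro
    linarith

lemma expectedRegret_baseProblem (T : ℕ) :
    (baseProblem hp hp' hΔ hΔ').expectedRegret alg T =
      Δ * ∫ h, (T - playCount (P := baseProblem hp hp' hΔ hΔ') (1 : Fin 3) h)
        ∂(baseProblem hp hp' hΔ hΔ').historyLaw alg T := by
  rw [BanditProblem.expectedRegret, ← integral_const_mul]
  refine integral_congr_ae (Filter.Eventually.of_forall fun h => ?_)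
  simp only [BanditProblem.regret, playCount]
  rw [BanditProblem.bestMean_eq (baseProblem_mean_le hp hp' hΔ hΔ')]
  simp only [baseProblem_mean, if_true]
  rw [mul_sub, Finset.mul_sum, show Δ * (T : ℝ) = ∑ _i : Fin T, Δ by simp [mul_comm],
    ← Finset.sum_sub_distrib]
  refine Finset.sum_congr rfl fun i _ => ?_
  split_ifs <;> simp

lemma le_expectedRegret_raisedProblem (T : ℕ) :
    Δ * ∫ h, playCount (P := raisedProblem hp hp' hΔ hΔ') (1 : Fin 3) h
        ∂(raisedProblem hp hp' hΔ hΔ').historyLaw alg T ≤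
      (raisedProblem hp hp' hΔ hΔ').expectedRegret alg T := by
  rw [BanditProblem.expectedRegret, ← integral_const_mul]
  set P := raisedProblem hp hp' hΔ hΔ'
  have hgap : ∀ a : Fin 3, P.bestMean - P.mean a = if a = 2 then 0 else
      if a = 1 then Δ else 2 * Δ := by
    intro a
    rw [BanditProblem.bestMean_eq (raisedProblem_mean_le hp hp' hΔ hΔ'), raisedProblem_mean,
      raisedProblem_mean, if_pos rfl]
    split_ifs <;> ring
  have hmeas : ∀ i : Fin T, Measurable fun h : P.History T => P.bestMean - P.mean (h i).1.2 :=
    fun i => (measurable_of_countable fun a : Fin 3 => P.bestMean - P.mean a).comp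
      (by fun_prop : Measurable fun h : P.History T => (h i).1.2)
  refine integral_mono ((integrable_playCount _ _).const_mul _) ?_ fun h => ?_
  · refine integrable_finsetSum _ fun i _ => Integrable.of_bound (hmeas i).aestronglyMeasurable
      (2 * Δ) (Filter.Eventually.of_forall fun h => ?_)
    rw [hgap, Real.norm_eq_abs, abs_le]
    split_ifs <;> constructor <;> linarith
  · simp only [BanditProblem.regret, playCount, Finset.mul_sum]
    refine Finset.sum_le_sum fun i _ => ?_
    rw [hgap]
    generalize (h i).1.2 = a
    revert a
    change ∀ a : Fin 3, _
    intro a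
    fin_cases a <;> simp [hΔ]

/-- The logarithm of the odds of a reward `1` for mean `1 / 2 + Δ`. -/
def logOdds (Δ : ℝ) : ℝ := Real.log ((1 / 2 + Δ) / (1 / 2 - Δ))

lemma logOdds_le (hΔ : 0 ≤ Δ) (hΔ' : Δ < 1 / 4) : logOdds Δ ≤ 6 * Δ := by
  have h1 : Real.log (1 / 2 + Δ) ≤ 2 * Δ - Real.log 2 := by
    have := Real.log_le_sub_one_of_pos (x := 2 * (1 / 2 + Δ)) (by linarith)
    rw [Real.log_mul (by norm_num) (by linarith)] at this
    linarith
  have h2 : -Real.log (1 / 2 - Δ) ≤ 4 * Δ + Real.log 2 := by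
    have := Real.one_sub_inv_le_log_of_pos (x := 2 * (1 / 2 - Δ)) (by linarith)
    rw [Real.log_mul (by norm_num) (by linarith)] at this
    have h3 : (2 * (1 / 2 - Δ))⁻¹ ≤ 1 + 4 * Δ := by
      rw [inv_le_iff_one_le_mul₀ (by linarith)]
      nlinarith
    linarith
  rw [logOdds, Real.log_div (by linarith) (by linarith)]
  linarith

/-- The log-likelihood ratio of one reward between the base problem and the raised problem. -/
def rewardLogRatio (Δ : ℝ) (x : Fin 3 × ℝ) : ℝ :=
  if x.1 = 2 then if x.2 = 1 then -logOdds Δ else logOdds Δ else 0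

lemma measurable_rewardLogRatio : Measurable (rewardLogRatio Δ) :=
  Measurable.ite ((measurableSet_singleton (2 : Fin 3)).preimage measurable_fst)
    (Measurable.ite ((measurableSet_singleton (1 : ℝ)).preimage measurable_snd)
      measurable_const measurable_const) measurable_const

lemma abs_rewardLogRatio_le (x : Fin 3 × ℝ) : |rewardLogRatio Δ x| ≤ |logOdds Δ| := by
  unfold rewardLogRatio
  split_ifs <;> simp

lemma raised_eq_withDensity (a : Fin 3) :
    bernoulliKernel (raisedMeans hΔ hΔ') a = (bernoulliKernel (baseMeans hΔ hΔ') a).withDensity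
      fun y => ENNReal.ofReal (Real.exp (-rewardLogRatio Δ (a, y))) := by
  have hpos : 0 < (1 / 2 + Δ) / (1 / 2 - Δ) := div_pos (by linarith) (by linarith)
  have h1 : (1 / 2 - Δ) ≠ 0 := by linarith
  have h2 : (1 / 2 + Δ) ≠ 0 := by linarith
  have he : Real.exp (logOdds Δ) = (1 / 2 + Δ) / (1 / 2 - Δ) := Real.exp_log hpos
  refine bernoulliMeasure_eq_withDensity ?_ ?_
  · fin_cases a
    · simp [baseMeans, raisedMeans, rewardLogRatio]
    · simp [baseMeans, raisedMeans, rewardLogRatio]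
    · change 1 / 2 + Δ = (1 / 2 - Δ) * Real.exp (-rewardLogRatio Δ (2, 1))
      simp only [rewardLogRatio, if_true, neg_neg, he]
      rw [mul_div_cancel₀ _ h1]
  · fin_cases a
    · simp [baseMeans, raisedMeans, rewardLogRatio]
    · simp [baseMeans, raisedMeans, rewardLogRatio]
    · change 1 - (1 / 2 + Δ) = (1 - (1 / 2 - Δ)) * Real.exp (-rewardLogRatio Δ (2, 0))
      simp only [rewardLogRatio, if_true, zero_ne_one, if_false, Real.exp_neg, he]
      rw [inv_div, show 1 - (1 / 2 - Δ) = 1 / 2 + Δ by ring]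
      rw [mul_div_cancel₀ _ h2]
      ring

/-- The Kullback-Leibler divergence between the base problem and the raised problem is that of one
reward of arm `2`, times the mean number of plays of this arm. -/
lemma integral_logLikelihood (T : ℕ) :
    ∫ h, BanditProblem.logLikelihood (P := baseProblem hp hp' hΔ hΔ') (rewardLogRatio Δ) h
        ∂(baseProblem hp hp' hΔ hΔ').historyLaw alg T =
      2 * Δ * logOdds Δ * ∫ h, playCount (P := baseProblem hp hp' hΔ hΔ') (2 : Fin 3) h
        ∂(baseProblem hp hp' hΔ hΔ').historyLaw alg T := by
  set P := baseProblem hp hp' hΔ hΔ'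
  set c := 2 * Δ * logOdds Δ
  have hg : Measurable fun x : Fin 3 × ℝ => rewardLogRatio Δ x - c * if x.1 = 2 then 1 else 0 :=
    measurable_rewardLogRatio.sub (measurable_const.mul
      (Measurable.ite ((measurableSet_singleton (2 : Fin 3)).preimage measurable_fst)
        measurable_const measurable_const))
  have key := BanditProblem.integral_sum_eq_zero (P := P) alg hg (C := |logOdds Δ| + |c|)
    (fun x => by
      refine (abs_sub _ _).trans (add_le_add (abs_rewardLogRatio_le x) ?_)
      split_ifs <;> simp) (fun (a : Fin 3) => by
      refine (integral_bernoulliKernel _ a _).trans ?_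
      fin_cases a
      · simp [rewardLogRatio]
      · simp [rewardLogRatio]
      · simp [rewardLogRatio, baseMeans, c]
        ring) T
  have hL : Integrable (fun h : P.History T =>
      BanditProblem.logLikelihood (rewardLogRatio Δ) h) (P.historyLaw alg T) :=
    Integrable.of_bound
      (BanditProblem.measurable_logLikelihood measurable_rewardLogRatio).aestronglyMeasurable
      (T * |logOdds Δ|) (Filter.Eventually.of_forall fun h =>
        BanditProblem.abs_logLikelihood_le abs_rewardLogRatio_le h)
  have hN := (integrable_playCount (P := P) (2 : Fin 3) (P.historyLaw alg T)).const_mul c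
  rw [← integral_const_mul, ← sub_eq_zero, ← integral_sub hL hN, ← key]
  refine integral_congr_ae (Filter.Eventually.of_forall fun h => ?_)
  simp only [BanditProblem.logLikelihood, playCount, Finset.mul_sum, Finset.sum_sub_distrib]

/-- The regret cannot be small on both problems: a learner with little regret on the base problem
has played arm `2` too rarely to notice that it is the best one in the raised problem. -/
theorem le_expectedRegret_add (T : ℕ) :
    Δ * T / 2 * Real.exp (-(2 * logOdds Δ * (p / (1 - p)) *
        (baseProblem hp hp' hΔ hΔ').expectedRegret alg T)) ≤
      (baseProblem hp hp' hΔ hΔ').expectedRegret alg T +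
        (raisedProblem hp hp' hΔ hΔ').expectedRegret alg T := by
  set P := baseProblem hp hp' hΔ hΔ'
  -- The raised problem is definitionally the base problem with its rewards replaced.
  have hbh := BanditProblem.mul_exp_neg_le_integral_add (P := P) alg
    (bernoulliKernel (raisedMeans hΔ hΔ')) (bernoulliKernel_support _)
    (exists_best_bernoulliKernel _) (measurable_rewardLogRatio (Δ := Δ)) abs_rewardLogRatio_le
    (raised_eq_withDensity hΔ hΔ') (t := T) (measurable_playCount (P := P) (1 : Fin 3))
    (playCount_nonneg _) (playCount_le _)
  have hK := integral_logLikelihood hp hp' hΔ hΔ' alg T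
  have hN := one_sub_mul_integral_playCount hp hp' alg (m := baseMeans hΔ hΔ') rfl T
  have hA := expectedRegret_baseProblem hp hp' hΔ hΔ' alg T
  have hB := le_expectedRegret_raisedProblem hp hp' hΔ hΔ' alg T
  have hexp : 2 * logOdds Δ * (p / (1 - p)) * P.expectedRegret alg T =
      ∫ h, BanditProblem.logLikelihood (P := P) (rewardLogRatio Δ) h ∂P.historyLaw alg T := by
    have h1p : 1 - p ≠ 0 := by linarith
    rw [hK, hA, eq_div_of_mul_eq h1p ((mul_comm _ _).trans hN)]
    field_simp
  rw [hexp]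
  have := mul_le_mul_of_nonneg_left hbh hΔ
  rw [mul_add, ← hA] at this
  refine le_trans (le_of_eq (by ring)) (this.trans (add_le_add le_rfl hB))

end

/-! ### The resulting bound and its asymptotics -/

/-- The arithmetic that turns `le_expectedRegret_add` into a bound on the larger regret. -/
lemma exists_min_le {p Δ T A B : ℝ} (hΔ : 0 < Δ) (hΔ' : Δ < 1 / 4) (hp : 0 < p) (hp' : p ≤ 1 / 4)
    (hA : 0 ≤ A)
    (h : Δ * T / 2 * Real.exp (-(2 * logOdds Δ * (p / (1 - p)) * A)) ≤ A + B) :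
    min (1 / 33 * (max (Real.log (Δ ^ 2 * T / 16)) 0 / (p * Δ))) (Real.sqrt T) ≤ max A B := by
  by_contra! hlt
  obtain ⟨hAm, hBm⟩ := max_lt_iff.mp hlt
  obtain ⟨hAL, hAT⟩ := lt_min_iff.mp hAm
  have hBT := (lt_min_iff.mp hBm).2
  have hlog : 0 < Real.log (Δ ^ 2 * T / 16) := by
    by_contra! hle
    rw [max_eq_right hle] at hAL
    simp at hAL
    linarith
  have hT0 : 0 < T := Real.sqrt_pos.mp (hA.trans_lt hAT)
  rw [max_eq_left hlog.le] at hAL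
  set s := Real.sqrt T
  have hs : 0 < s := Real.sqrt_pos.mpr hT0
  have hsT : s ^ 2 = T := Real.sq_sqrt hT0.le
  have hΛ : Real.log (Δ ^ 2 * T / 16) = 2 * Real.log (Δ * s / 4) := by
    rw [← hsT, show Δ ^ 2 * s ^ 2 / 16 = (Δ * s / 4) ^ 2 by ring, Real.log_pow]
    norm_num
  -- The divergence is at most `16 * p * Δ * A`, and `A` is below `2 / 33` of
  -- `log (Δ * √T / 4) / (p * Δ)`: here `32 ≤ 33` is what is needed.
  have hexp : 2 * logOdds Δ * (p / (1 - p)) * A ≤ Real.log (Δ * s / 4) := by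
    have hq : p / (1 - p) ≤ 4 / 3 * p := by
      rw [div_le_iff₀ (by linarith)]
      nlinarith
    have hq0 : 0 ≤ p / (1 - p) := div_nonneg hp.le (by linarith)
    have h16 : 2 * logOdds Δ * (p / (1 - p)) * A ≤ 16 * (p * Δ) * A := by
      refine mul_le_mul_of_nonneg_right ?_ hA
      calc 2 * logOdds Δ * (p / (1 - p)) ≤ 2 * (6 * Δ) * (p / (1 - p)) := by
            gcongr
            exact logOdds_le hΔ.le hΔ'
        _ ≤ 2 * (6 * Δ) * (4 / 3 * p) := by gcongr
        _ = 16 * (p * Δ) := by ring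
    have hpΔ : 0 < p * Δ := mul_pos hp hΔ
    have : p * Δ * A ≤ 1 / 33 * (2 * Real.log (Δ * s / 4)) := by
      rw [hΛ, ← mul_div_assoc, lt_div_iff₀ hpΔ] at hAL
      linarith
    linarith
  have hpos : 0 < Δ * s / 4 := by positivity
  have hge : (Δ * s / 4)⁻¹ ≤ Real.exp (-(2 * logOdds Δ * (p / (1 - p)) * A)) := by
    rw [← Real.exp_log (inv_pos.mpr hpos), Real.log_inv]
    exact Real.exp_le_exp.mpr (neg_le_neg hexp)
  have h2s : Δ * T / 2 * (Δ * s / 4)⁻¹ = 2 * s := by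
    rw [← hsT]
    field_simp
    norm_num
  have := (mul_le_mul_of_nonneg_left hge (by positivity : 0 ≤ Δ * T / 2)).trans h
  linarith

open Filter Asymptotics in
/-- For large horizons the logarithmic term is below `√T`, and its constants are absorbed. -/
lemma isEquivalent_min_log_sqrt {p Δ : ℝ} (hΔ : 0 < Δ) (hp : 0 < p) :
    IsEquivalent atTop
      (fun T : ℕ => min (1 / 33 * (max (Real.log (Δ ^ 2 * T / 16)) 0 / (p * Δ))) (Real.sqrt T))
      (fun T : ℕ => 1 / 33 * (Real.log T / (p * Δ))) := by
  have hlogT : Tendsto (fun T : ℕ => Real.log T) atTop atTop :=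
    Real.tendsto_log_atTop.comp tendsto_natCast_atTop_atTop
  have hpΔ : 0 < p * Δ := mul_pos hp hΔ
  have hlog : IsEquivalent atTop (fun T : ℕ => Real.log (Δ ^ 2 * T / 16))
      (fun T : ℕ => Real.log T) := by
    have hconst : (fun _ : ℕ => Real.log (Δ ^ 2 / 16)) =o[atTop] fun T : ℕ => Real.log T :=
      isLittleO_const_left.mpr (Or.inr (tendsto_norm_atTop_atTop.comp hlogT))
    refine hconst.congr' ?_ EventuallyEq.rfl
    filter_upwards [eventually_gt_atTop 0] with T hT
    have hT' : (T : ℝ) ≠ 0 := by positivity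
    simp only [Pi.sub_apply]
    rw [show Δ ^ 2 * (T : ℝ) / 16 = Δ ^ 2 / 16 * T by ring, Real.log_mul (by positivity) hT']
    ring
  have hmain : IsEquivalent atTop (fun T : ℕ => 1 / 33 * (Real.log (Δ ^ 2 * T / 16) / (p * Δ)))
      (fun T : ℕ => 1 / 33 * (Real.log T / (p * Δ))) :=
    IsEquivalent.mul .refl (IsEquivalent.div hlog .refl)
  refine hmain.congr_left ?_
  have hsmall : (fun T : ℕ => 1 / 33 * (Real.log (Δ ^ 2 * T / 16) / (p * Δ))) =o[atTop]
      fun T : ℕ => Real.sqrt T := by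
    have h1 : (fun T : ℕ => Real.log T) =o[atTop] fun T : ℕ => Real.sqrt T := by
      have := (isLittleO_log_rpow_atTop (r := 1 / 2) (by norm_num)).comp_tendsto
        tendsto_natCast_atTop_atTop
      simpa only [Function.comp_def, Real.sqrt_eq_rpow] using this
    refine hmain.isBigO.trans_isLittleO ?_
    have := h1.const_mul_left (1 / 33 * (p * Δ)⁻¹)
    refine this.congr_left fun T => ?_
    ring
  filter_upwards [hsmall.bound one_pos, hlog.symm.tendsto_atTop hlogT |>.eventually_ge_atTop 0]
    with T hT hT0
  rw [max_eq_left hT0, min_eq_left]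
  have := (le_abs_self _).trans hT
  rwa [one_mul, Real.norm_eq_abs, abs_of_nonneg (Real.sqrt_nonneg _)] at this

end

theorem theorem2 (Δ p : ℝ) (hΔ : 0 < Δ) (hΔ' : Δ < 1 / 4) (hp : 0 < p) (hp' : p ≤ 1 / 4) :
    (∀ (T : ℕ) (alg : BanditAlgorithm), ∃ P : BanditProblem, P.InClass Δ p ∧
      min (1 / 33 * (max (Real.log (Δ ^ 2 * T / 16)) 0 / (p * Δ))) (Real.sqrt T)
        ≤ P.expectedRegret alg T) ∧
    Asymptotics.IsEquivalent Filter.atTop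
      (fun T : ℕ => min (1 / 33 * (max (Real.log (Δ ^ 2 * T / 16)) 0 / (p * Δ))) (Real.sqrt T))
      (fun T : ℕ => 1 / 33 * (Real.log T / (p * Δ))) := by
  refine ⟨fun T alg => ?_, isEquivalent_min_log_sqrt hΔ hp⟩
  have hp2 : 2 * p ≤ 1 := by linarith
  have hΔ2 : Δ < 1 / 2 := by linarith
  have hmax := exists_min_le hΔ hΔ' hp hp'
    (BanditProblem.expectedRegret_nonneg _ alg T)
    (le_expectedRegret_add hp.le hp2 hΔ.le hΔ2 alg T)
  rcases le_max_iff.mp hmax with h | h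
  · exact ⟨_, baseProblem_inClass hp.le hp2 hΔ.le hΔ2 hΔ, h⟩
  · exact ⟨_, raisedProblem_inClass hp.le hp2 hΔ.le hΔ2 hΔ, h⟩
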